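/- Consider a game with $N\ge 1$ experts. At step $t=1,2,\dots$ expert $i$ suffers a real (possibly negative, possibly unbounded) loss $s^i_t$; the experts are oblivious, i.e. the losses are fixed in advance and do not depend on the random choices of the algorithm. Put $s^i_{1:t}=\sum_{j=1}^t s^i_j$. For a constant $v_0\ge 0$ let $v_t=v_0+\sum_{j=1}^t\max_i|s^i_j|$ be the volume of the game and $\mathrm{fluc}(t)=\max_i|s^i_t|/v_t$ (with $0/0=0$). Let $\gamma(t)$, $t\ge 1$, be a non-increasing real function with $0\le\gamma(t)\le 1$ and $\gamma(t)\to 0$ as $t\to\infty$, and let $a>0$. Put $$\mu_t=\sqrt{\frac{2a(e^{3/a}-1)}{1+\ln N}}\,(\gamma(t))^{1/2},\qquad \epsilon_t=\frac{1}{\mu_t v_{t-1}}$$ (with $1/\epsilon_t=0$ if $\mu_tv_{t-1}=0$). Let $\xi^i_t$, $i=1,\dots,N$, $t=1,2,\dots$, be i.i.d. random variables with the exponential density $e^{-x}$, $x\ge 0$. At each step $t\ge1$ the follow-the-perturbed-leader algorithm PROT, with fresh perturbations at each step, follows an expert $$I_t\in\operatorname*{argmin}_{i=1,\dots,N}\Big\{s^i_{1:t-1}-\frac{1}{\epsilon_t}\xi^i_t\Big\}$$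 (ties being broken arbitrarily), and suffers the loss $s_t=s^{I_t}_t$; put $s_{1:T}=\sum_{t=1}^T s^{I_t}_t$. Assume that $\mathrm{fluc}(t)\le\gamma(t)$ for all $t\ge 1$, that the game is non-degenerate, i.e. $v_t\to\infty$ as $t\to\infty$, and that $\sum_{t=1}^\infty(\gamma(t))^2<\infty$. Then PROT is Hannan consistent in the modified sense: $$\limsup_{T\to\infty}\frac{1}{v_T}\Big(s_{1:T}-\min_{i=1,\dots,N}s^i_{1:T}\Big)\le 0\quad\text{almost surely.}$$ -/

import Mathlib

open MeasureTheory ProbabilityTheory Filter Topology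

namespace PredictionGame

variable {N : ℕ} [NeZero N] {Ω : Type*}

/-- Cumulative loss `s^i_{1:t}` of expert `i` on steps `1, …, t`, where `s t i` is the loss of
expert `i` at step `t ≥ 1`. The value `s 0 i` is never used. -/
noncomputable def cumLoss (s : ℕ → Fin N → ℝ) (t : ℕ) (i : Fin N) : ℝ :=
  ∑ j ∈ Finset.Icc 1 t, s j i

/-- The cumulative loss `min_i s^i_{1:t}` of the best expert. -/
noncomputable def bestLoss (s : ℕ → Fin N → ℝ) (t : ℕ) : ℝ :=
  Finset.univ.inf' Finset.univ_nonempty (fun i => cumLoss s t i)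

/-- The largest absolute one-step loss `max_i |s^i_t|` at step `t`. -/
noncomputable def maxAbsLoss (s : ℕ → Fin N → ℝ) (t : ℕ) : ℝ :=
  Finset.univ.sup' Finset.univ_nonempty (fun i => |s t i|)

/-- The volume `v_t = v₀ + ∑_{j=1}^t max_i |s^i_j|` of the game. -/
noncomputable def volume (v₀ : ℝ) (s : ℕ → Fin N → ℝ) (t : ℕ) : ℝ :=
  v₀ + ∑ j ∈ Finset.Icc 1 t, maxAbsLoss s j

/-- The scaled fluctuation `fluc(t) = Δv_t / v_t = max_i |s^i_t| / v_t`, with `0 / 0 = 0`. -/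
noncomputable def fluc (v₀ : ℝ) (s : ℕ → Fin N → ℝ) (t : ℕ) : ℝ :=
  maxAbsLoss s t / volume v₀ s t

/-- The game is non-degenerate: `v_t → ∞`. -/
def NonDegenerate (v₀ : ℝ) (s : ℕ → Fin N → ℝ) : Prop :=
  Tendsto (volume v₀ s) atTop atTop

/-- Cumulative loss `s_{1:T} = ∑_{t=1}^T s_t^{I_t}` of an algorithm that follows expert `I t` at
step `t`. -/
noncomputable def algLoss (s : ℕ → Fin N → ℝ) (I : ℕ → Ω → Fin N) (T : ℕ) (ω : Ω) : ℝ :=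
  ∑ t ∈ Finset.Icc 1 T, s t (I t ω)

/-- Hannan consistency in the modified sense (regret normalized by the volume of the game).
The upper limit is taken in the extended reals. -/
def HannanConsistent [MeasurableSpace Ω] (P : Measure Ω) (v₀ : ℝ) (s : ℕ → Fin N → ℝ)
    (I : ℕ → Ω → Fin N) : Prop :=
  ∀ᵐ ω ∂P,
    limsup (fun T : ℕ =>
      ((1 / volume v₀ s T * (algLoss s I T ω - bestLoss s T) : ℝ) : EReal)) atTop ≤ 0

/-- The exponent `α_t`, as a function of `g = γ(t) ∈ (0, 1)`. -/
noncomputable def alpha (N : ℕ) (a g : ℝ) : ℝ :=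
  1 / 2 * (1 - Real.log (a * (1 + Real.log N) / (2 * (Real.exp (3 / a) - 1))) / Real.log g)

/-- The scaling `μ_t = √(2 a (e^{3/a} - 1) / (1 + ln N)) · γ(t)^{1/2}`, as a function of
`g = γ(t)`. -/
noncomputable def mu (N : ℕ) (a g : ℝ) : ℝ :=
  √(2 * a * (Real.exp (3 / a) - 1) / (1 + Real.log N)) * g ^ (1 / 2 : ℝ)

/-- The two forms of `μ_t` agree: `μ_t = a γ(t)^{α_t}` whenever `0 < γ(t) < 1`. -/
theorem mu_eq_rpow_alpha (N : ℕ) {a g : ℝ} (ha : 0 < a) (hg : 0 < g) (hg1 : g < 1) :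
    mu N a g = a * g ^ alpha N a g := by
  have hN : 0 ≤ Real.log N := Real.log_natCast_nonneg N
  have he : 0 < Real.exp (3 / a) - 1 := by
    have := Real.add_one_lt_exp (x := 3 / a) (by positivity)
    have : 0 < 3 / a := by positivity
    linarith
  have hl : Real.log g ≠ 0 := (Real.log_neg hg hg1).ne
  set B := a * (1 + Real.log N) / (2 * (Real.exp (3 / a) - 1)) with hB
  have hBpos : 0 < B := by positivity
  have h1 : g ^ alpha N a g = g ^ (1 / 2 : ℝ) * B ^ (-(1 / 2) : ℝ) := by
    rw [Real.rpow_def_of_pos hg, Real.rpow_def_of_pos hg, Real.rpow_def_of_pos hBpos,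
      ← Real.exp_add]
    congr 1
    unfold alpha
    rw [← hB]
    field_simp
    ring
  have h2 : a * B ^ (-(1 / 2) : ℝ) =
      √(2 * a * (Real.exp (3 / a) - 1) / (1 + Real.log N)) := by
    rw [Real.rpow_neg hBpos.le, ← Real.sqrt_eq_rpow, ← Real.sqrt_inv]
    nth_rewrite 1 [← Real.sqrt_sq ha.le]
    rw [← Real.sqrt_mul (sq_nonneg a)]
    congr 1
    rw [hB]
    field_simp
  rw [h1, mu, ← h2]
  ring

/-- The learning rate `ε_t = 1 / (μ_t v_{t-1})` at step `t ≥ 1`. If `μ_t v_{t-1} = 0`, then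
`1 / learningRate … = 0`, in agreement with the convention `ε_t = ∞`, `1 / ε_t = 0`. -/
noncomputable def learningRate (a : ℝ) (γ : ℕ → ℝ) (v₀ : ℝ) (s : ℕ → Fin N → ℝ) (t : ℕ) : ℝ :=
  1 / (mu N a (γ t) * volume v₀ s (t - 1))

/-- `I` is the sequence of experts chosen by the follow-the-perturbed-leader algorithm PROT with
parameter `a` and perturbations `ξ t i`: at each step `t ≥ 1`,
`I t ∈ argmin_i (s^i_{1:t-1} - ξ^i_t / ε_t)`. Ties may be broken in any way. -/
def IsPROT (a : ℝ) (γ : ℕ → ℝ) (v₀ : ℝ) (s : ℕ → Fin N → ℝ) (ξ : ℕ → Fin N → Ω → ℝ)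
    (I : ℕ → Ω → Fin N) : Prop :=
  ∀ t, 1 ≤ t → ∀ ω, ∀ i,
    cumLoss s (t - 1) (I t ω) - 1 / learningRate a γ v₀ s t * ξ t (I t ω) ω ≤
      cumLoss s (t - 1) i - 1 / learningRate a γ v₀ s t * ξ t i ω

/-- The perturbations `ξ t i`, `t ≥ 1`, `i = 1, …, N`, are i.i.d. with density `e^{-x}` on
`[0, ∞)`. -/
structure IsExpIID [MeasurableSpace Ω] (P : Measure Ω) (ξ : ℕ → Fin N → Ω → ℝ) : Prop where
  hasLaw : ∀ t, 1 ≤ t → ∀ i, HasLaw (ξ t i) (expMeasure 1) P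
  indep : iIndepFun (fun p : ℕ × Fin N => ξ (p.1 + 1) p.2) P

end PredictionGame

/-! With oblivious losses and fresh perturbations, the step losses are functions of independent
vectors, so expectation and deviation can be treated apart. Ties are removed by charging the worst
leader, `topLoss`, which is a measurable function of the perturbation. Expectation: only the law at
each step matters, so one vector `x` may serve all steps. A leader already knowing the current
losses then has regret at most the total upward drift of the scales `μ_t v_{t-1}` times `∑ i, x i`
(`sum_topLoss_le_cumLoss`). Not knowing them costs a factor `exp H`, since translating exponential
variables by `h ≥ 0` changes their law by at most `exp (∑ i, h i)` (`integral_topLoss_le_add`). The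
price per unit of volume is of order `μ_t` in the first case and `γ(t) / μ_t` in the second; with
`μ_t` of order `√γ(t)` both tend to 0, and so do their volume-weighted averages. Deviation: centred
losses divided by `v_t` are bounded by `2 γ(t)`, which is square summable, so their series converges
almost surely and Kronecker's lemma gives `o(v_T)`. -/

namespace PredictionGame

/-! ### The exponential law and its translates. -/

/-- A translate of the exponential law is a multiple of its restriction to a half-line. -/
theorem expMeasure_map_add {h : ℝ} (hh : 0 ≤ h) :
    (expMeasure 1).map (· + h) =
      ENNReal.ofReal (Real.exp h) • (expMeasure 1).restrict (Set.Ici h) := by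
  ext A hA
  have hm : Measurable (exponentialPDF 1) :=
    (measurable_exponentialPDFReal 1).ennreal_ofReal
  have hexp : expMeasure 1 = (MeasureTheory.volume : Measure ℝ).withDensity (exponentialPDF 1) := rfl
  rw [Measure.map_apply (by fun_prop) hA, Measure.smul_apply, Measure.restrict_apply hA, hexp,
    withDensity_apply _ (hA.preimage (by fun_prop)),
    withDensity_apply _ (hA.inter measurableSet_Ici),
    ← lintegral_indicator (hA.preimage (by fun_prop)),
    ← lintegral_indicator (hA.inter measurableSet_Ici), smul_eq_mul,
    ← lintegral_const_mul _ (hm.indicator (hA.inter measurableSet_Ici)),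
    ← lintegral_sub_right_eq_self _ h]
  -- Both integrands vanish unless `x ∈ A` and `h ≤ x`; there `exp (-(x - h)) = exp h * exp (-x)`.
  refine lintegral_congr fun x => ?_
  by_cases hx : x ∈ A
  · by_cases hxh : h ≤ x
    · have h1 : x - h ∈ (· + h) ⁻¹' A := by simpa using hx
      rw [Set.indicator_of_mem h1, Set.indicator_of_mem (show x ∈ A ∩ Set.Ici h from ⟨hx, hxh⟩),
        exponentialPDF_of_nonneg (by linarith), exponentialPDF_of_nonneg (by linarith),
        ← ENNReal.ofReal_mul (Real.exp_pos _).le]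
      congr 1
      rw [one_mul, one_mul, one_mul, one_mul, ← Real.exp_add]
      congr 1
      ring
    · have h1 : x - h ∈ (· + h) ⁻¹' A := by simpa using hx
      rw [Set.indicator_of_mem h1, Set.indicator_of_notMem (fun h' => hxh h'.2),
        exponentialPDF_of_neg (by linarith), mul_zero]
  · have h1 : x - h ∉ (· + h) ⁻¹' A := by simpa using hx
    rw [Set.indicator_of_notMem h1, Set.indicator_of_notMem (fun h' => hx h'.1), mul_zero]

instance isProbabilityMeasure_expMeasure_one : IsProbabilityMeasure (expMeasure 1) :=
  isProbabilityMeasure_expMeasure one_pos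

theorem ae_nonneg_expMeasure : ∀ᵐ x ∂(expMeasure 1), 0 ≤ x := by
  -- The translation formula with `h = 0` says that the law equals its restriction to `[0, ∞)`.
  have h := congrArg (fun m : Measure ℝ => m (Set.Ici 0)ᶜ) (expMeasure_map_add le_rfl)
  simp only [Measure.smul_apply, Measure.restrict_apply measurableSet_Ici.compl,
    Set.compl_inter_self, measure_empty, smul_zero, add_zero, Measure.map_id'] at h
  exact h

theorem integrable_id_expMeasure : Integrable (fun x : ℝ => x) (expMeasure 1) := by
  have hexp : expMeasure 1 = (MeasureTheory.volume : Measure ℝ).withDensity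
    (fun x => ENNReal.ofReal (exponentialPDFReal 1 x)) := rfl
  rw [hexp, integrable_withDensity_iff_integrable_smul' (by fun_prop) (by simp)]
  have h1 : IntegrableOn (fun x : ℝ => Real.exp (-x) * x ^ ((2 : ℝ) - 1)) (Set.Ioi 0) :=
    Real.GammaIntegral_convergent two_pos
  rw [← integrable_indicator_iff measurableSet_Ioi] at h1
  refine h1.congr (Eventually.of_forall fun x => ?_)
  dsimp only
  rw [ENNReal.toReal_ofReal (exponentialPDFReal_nonneg one_pos x), exponentialPDFReal, gammaPDFReal]
  by_cases hx : 0 < x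
  · rw [Set.indicator_of_mem (show x ∈ Set.Ioi 0 from hx), if_pos hx.le]
    norm_num
  · rw [Set.indicator_of_notMem (show x ∉ Set.Ioi 0 from hx)]
    rcases (not_lt.1 hx).eq_or_lt with h0 | h0
    · simp [h0]
    · rw [if_neg (by linarith)]
      simp

/-- The law of a vector of `N` independent standard exponential variables. -/
noncomputable def expLaw (N : ℕ) : Measure (Fin N → ℝ) := Measure.pi fun _ => expMeasure 1

instance isProbabilityMeasure_expLaw (N : ℕ) : IsProbabilityMeasure (expLaw N) :=
  inferInstanceAs (IsProbabilityMeasure (Measure.pi _))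

theorem expLaw_map_add {N : ℕ} {h : Fin N → ℝ} (hh : ∀ i, 0 ≤ h i) :
    (expLaw N).map (· + h) = ENNReal.ofReal (Real.exp (∑ i, h i)) •
      (expLaw N).restrict (Set.univ.pi fun i => Set.Ici (h i)) := by
  have h1 : (expLaw N).map (· + h) = Measure.pi fun i => (expMeasure 1).map (· + h i) :=
    Measure.pi_map_pi (μ := fun _ : Fin N => expMeasure 1) (f := fun i x => x + h i)
      (fun i => by fun_prop)
  rw [h1]
  have (i : Fin N) : IsProbabilityMeasure ((expMeasure 1).map (· + h i)) :=
    Measure.isProbabilityMeasure_map (by fun_prop)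
  refine Measure.pi_eq fun A hA => ?_
  rw [Measure.smul_apply, Measure.restrict_apply (MeasurableSet.univ_pi hA), ← Set.pi_inter_distrib,
    expLaw, Measure.pi_pi, Real.exp_sum,
    ENNReal.ofReal_prod_of_nonneg fun i _ => (Real.exp_pos _).le, smul_eq_mul,
    ← Finset.prod_mul_distrib]
  refine Finset.prod_congr rfl fun i _ => ?_
  rw [expMeasure_map_add (hh i), Measure.smul_apply, Measure.restrict_apply (hA i), smul_eq_mul]

/-- Translating the perturbations by a nonnegative vector `h` increases the expectation of a
nonnegative function at most by the factor `exp (∑ i, h i)`. -/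
theorem integral_comp_add_le_expLaw {N : ℕ} {h : Fin N → ℝ} (hh : ∀ i, 0 ≤ h i)
    {F : (Fin N → ℝ) → ℝ} (hF : Measurable F) (hF0 : ∀ x, 0 ≤ F x)
    (hFi : Integrable F (expLaw N)) :
    ∫ x, F (x + h) ∂(expLaw N) ≤ Real.exp (∑ i, h i) * ∫ x, F x ∂(expLaw N) := by
  have h1 : ∫ x, F (x + h) ∂(expLaw N) = ∫ x, F x ∂((expLaw N).map (· + h)) :=
    (integral_map (by fun_prop) hF.aestronglyMeasurable).symm
  rw [h1, expLaw_map_add hh, integral_smul_measure, ENNReal.toReal_ofReal (Real.exp_pos _).le,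
    smul_eq_mul]
  exact mul_le_mul_of_nonneg_left
    (setIntegral_le_integral hFi (Eventually.of_forall hF0)) (Real.exp_pos _).le

theorem ae_nonneg_expLaw (N : ℕ) : ∀ᵐ x ∂(expLaw N), ∀ i, 0 ≤ x i := by
  rw [ae_all_iff]
  intro i
  exact (measurePreserving_eval (fun _ : Fin N => expMeasure 1) i).quasiMeasurePreserving.ae
    ae_nonneg_expMeasure

theorem integrable_sum_expLaw (N : ℕ) : Integrable (fun x => ∑ i, x i) (expLaw N) :=
  integrable_finsetSum _ fun i _ =>
    (measurePreserving_eval (fun _ : Fin N => expMeasure 1) i).integrable_comp_of_integrable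
      integrable_id_expMeasure

/-! ### Independent rows of the perturbation array. -/

theorem map_row_eq_expLaw {N : ℕ} {Ω : Type*} [MeasurableSpace Ω] {P : Measure Ω}
    [IsProbabilityMeasure P] {X : ℕ → Fin N → Ω → ℝ} (hm : ∀ t i, Measurable (X t i))
    (hind : iIndepFun (fun p : ℕ × Fin N => X p.1 p.2) P)
    (hlaw : ∀ t i, P.map (X t i) = expMeasure 1) (t : ℕ) :
    P.map (fun ω i => X t i ω) = expLaw N := by
  have h1 : iIndepFun (fun i => X t i) P :=
    hind.precomp (g := fun i : Fin N => (t, i)) (Prod.mk_right_injective t)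
  have h2 := h1.map_fun_eq_pi_map fun i => (hm t i).aemeasurable
  simp only [hlaw] at h2
  exact h2

/-- The array has a product law over `ℕ × Fin N`; currying turns it into a product over `ℕ` of
copies of `expLaw N`. -/
theorem iIndepFun_rows {N : ℕ} {Ω : Type*} [MeasurableSpace Ω] {P : Measure Ω}
    [IsProbabilityMeasure P] {X : ℕ → Fin N → Ω → ℝ} (hm : ∀ t i, Measurable (X t i))
    (hind : iIndepFun (fun p : ℕ × Fin N => X p.1 p.2) P)
    (hlaw : ∀ t i, P.map (X t i) = expMeasure 1) :
    iIndepFun (fun t ω i => X t i ω) P := by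
  rw [iIndepFun_iff_map_fun_eq_infinitePi_map fun t => measurable_pi_iff.2 (hm t)]
  have h1 := hind.map_fun_eq_infinitePi_map fun p : ℕ × Fin N => hm p.1 p.2
  simp only [hlaw] at h1
  have h2 := Measure.infinitePi_map_curry (fun (_ : ℕ) (_ : Fin N) => expMeasure 1)
  simp only [map_row_eq_expLaw hm hind hlaw, expLaw]
  simp only [Measure.infinitePi_eq_pi] at h2
  rw [← h2, ← h1, Measure.map_map (MeasurableEquiv.measurable _)
    (measurable_pi_iff.2 fun p : ℕ × Fin N => hm p.1 p.2)]
  rfl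

/-- The rows of an i.i.d. exponential array agree almost surely with independent measurable random
vectors of law `expLaw N`. -/
theorem IsExpIID.exists_rows {N : ℕ} {Ω : Type*} [MeasurableSpace Ω] {P : Measure Ω}
    [IsProbabilityMeasure P] {ξ : ℕ → Fin N → Ω → ℝ} (hξ : IsExpIID P ξ) :
    ∃ ζ : ℕ → Ω → Fin N → ℝ, (∀ t, Measurable (ζ t)) ∧ (∀ t, P.map (ζ t) = expLaw N) ∧
      iIndepFun ζ P ∧ ∀ᵐ ω ∂P, ∀ t i, ξ (t + 1) i ω = ζ t ω i := by
  have hae (t : ℕ) (i : Fin N) : AEMeasurable (ξ (t + 1) i) P :=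
    (hξ.hasLaw (t + 1) (by omega) i).aemeasurable
  choose X hm hX using hae
  have hind : iIndepFun (fun p : ℕ × Fin N => X p.1 p.2) P :=
    (iIndepFun_congr fun p : ℕ × Fin N => hX p.1 p.2).1 hξ.indep
  have hlaw (t : ℕ) (i : Fin N) : P.map (X t i) = expMeasure 1 := by
    rw [← Measure.map_congr (hX t i)]
    exact (hξ.hasLaw (t + 1) (by omega) i).map_eq
  refine ⟨fun t ω i => X t i ω, fun t => measurable_pi_iff.2 (hm t),
    map_row_eq_expLaw hm hind hlaw, iIndepFun_rows hm hind hlaw, ?_⟩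
  rw [ae_all_iff]
  intro t
  rw [ae_all_iff]
  exact hX t

/-! ### Weighted averages, Kronecker's lemma and convergence of random series. -/

/-- Averages of a null sequence with weights `v (t + 1) - v t`, where `v` increases to infinity. -/
theorem tendsto_weighted_average_zero {v b : ℕ → ℝ} (hv : Monotone v)
    (hv' : Tendsto v atTop atTop) (hb : Tendsto b atTop (𝓝 0)) :
    Tendsto (fun T => (∑ t ∈ Finset.range T, b t * (v (t + 1) - v t)) / v T) atTop (𝓝 0) := by
  have hsum (T : ℕ) : ∑ t ∈ Finset.range T, (v (t + 1) - v t) = v T - v 0 :=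
    Finset.sum_range_sub v T
  have h1 : (fun t => b t * (v (t + 1) - v t)) =o[atTop] fun t => v (t + 1) - v t := by
    simpa using ((Asymptotics.isLittleO_one_iff ℝ).2 hb).mul_isBigO
      (Asymptotics.isBigO_refl (fun t => v (t + 1) - v t) atTop)
  have h2 := h1.sum_range (fun t => sub_nonneg.2 (hv t.le_succ))
    (by simpa only [hsum, ← sub_eq_add_neg] using tendsto_atTop_add_const_right _ (-v 0) hv')
  simp only [hsum] at h2
  have h3 : (fun T => v T - v 0) =O[atTop] v :=
    (Asymptotics.isBigO_refl v atTop).sub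
      ((Asymptotics.isLittleO_const_left.2
        (Or.inr (tendsto_norm_atTop_atTop.comp hv'))).isBigO)
  exact (h2.trans_isBigO h3).tendsto_div_nhds_zero

/-- **Kronecker's lemma.** -/
theorem kronecker {v x : ℕ → ℝ} (hv : Monotone v) (hv' : Tendsto v atTop atTop) {l : ℝ}
    (hx : Tendsto (fun T => ∑ t ∈ Finset.range T, x t) atTop (𝓝 l)) :
    Tendsto (fun T => (∑ t ∈ Finset.range T, v (t + 1) * x t) / v T) atTop (𝓝 0) := by
  -- Partial sums are centred at the limit, so that Abel summation leaves only terms in the null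
  -- sequence `S`.
  set S : ℕ → ℝ := fun T => ∑ t ∈ Finset.range T, x t - l with hS
  have hS0 : Tendsto S atTop (𝓝 0) := by simpa using hx.sub_const l
  have habel (T : ℕ) : ∑ t ∈ Finset.range T, v (t + 1) * x t =
      v T * S T - v 0 * S 0 - ∑ t ∈ Finset.range T, S t * (v (t + 1) - v t) := by
    induction T with
    | zero => simp
    | succ T ih =>
      have : S (T + 1) = S T + x T := by simp only [hS, Finset.sum_range_succ]; ring
      rw [Finset.sum_range_succ, Finset.sum_range_succ, ih, this]
      ring
  have h1 := tendsto_weighted_average_zero hv hv' hS0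
  have h2 : Tendsto (fun T => v 0 * S 0 / v T) atTop (𝓝 0) := hv'.const_div_atTop _
  have h3 := (hS0.sub h2).sub h1
  simp only [sub_zero] at h3
  refine h3.congr' ?_
  filter_upwards [hv'.eventually_gt_atTop 0] with T hT
  rw [habel]
  field_simp

/-- A series of independent centred random variables `Y t` with `|Y t| ≤ b t` and
`∑ t, b t ^ 2 < ∞` converges almost surely. -/
theorem ae_tendsto_sum_of_iIndepFun {Ω : Type*} [MeasurableSpace Ω] {P : Measure Ω}
    [IsProbabilityMeasure P] {Y : ℕ → Ω → ℝ} {b : ℕ → ℝ} (hY : ∀ t, Measurable (Y t))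
    (hind : iIndepFun Y P) (hmean : ∀ t, ∫ ω, Y t ω ∂P = 0) (hb : ∀ t ω, |Y t ω| ≤ b t)
    (hsum : Summable fun t => b t ^ 2) :
    ∀ᵐ ω ∂P, ∃ l, Tendsto (fun T => ∑ t ∈ Finset.range T, Y t ω) atTop (𝓝 l) := by
  have hsm (t : ℕ) : StronglyMeasurable (Y t) := (hY t).stronglyMeasurable
  have hL (t : ℕ) : MemLp (Y t) 2 P :=
    MemLp.of_bound (hY t).aestronglyMeasurable (b t) (Eventually.of_forall (hb t))
  -- The sum runs up to `Y n` inclusive: `M n` is then adapted, and the increment `Y (n + 1)` is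
  -- independent of the past up to `n`.
  set M : ℕ → Ω → ℝ := fun n => ∑ t ∈ Finset.range (n + 1), Y t with hM
  have hML (n : ℕ) : MemLp (M n) 2 P := memLp_finsetSum' _ fun t _ => hL t
  have hMI (n : ℕ) : Integrable (M n) P := (hML n).integrable (by norm_num)
  have hmart : Martingale M (Filtration.natural Y hsm) P := by
    refine martingale_of_condExp_sub_eq_zero_nat (fun n => ?_) hMI fun n => ?_
    · refine Finset.stronglyMeasurable_sum _ fun t ht => ?_
      exact (Filtration.stronglyAdapted_natural hsm t).mono
        ((Filtration.natural Y hsm).mono (Nat.lt_succ_iff.1 (Finset.mem_range.1 ht)))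
    · have h1 : M (n + 1) - M n = Y (n + 1) := by
        simp only [hM]
        rw [Finset.sum_range_succ _ (n + 1), add_sub_cancel_left]
      rw [h1]
      refine (hind.condExp_natural_ae_eq_of_lt hsm n.lt_succ_self).trans ?_
      simp only [hmean]
      rfl
  have hvar (n : ℕ) : ∫ ω, M n ω ^ 2 ∂P ≤ ∑' t, b t ^ 2 := by
    have h0 : ∫ ω, M n ω ∂P = 0 := by
      simp only [hM, Finset.sum_apply]
      rw [integral_finsetSum _ fun t _ => (hL t).integrable (by norm_num)]
      simp [hmean]
    rw [← variance_of_integral_eq_zero (hML n).aemeasurable h0, hM,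
      IndepFun.variance_sum (fun t _ => hL t) fun i _ j _ hij => hind.indepFun hij]
    refine (Finset.sum_le_sum fun t _ => ?_).trans
      (hsum.sum_le_tsum (Finset.range (n + 1)) fun t _ => sq_nonneg _)
    rw [variance_of_integral_eq_zero (hY t).aemeasurable (hmean t)]
    have := integral_mono (hL t).integrable_sq (integrable_const (b t ^ 2))
      fun ω => sq_le_sq' (by linarith [(abs_le.1 (hb t ω)).1]) (abs_le.1 (hb t ω)).2
    simpa using this
  have hbdd (n : ℕ) : eLpNorm (M n) 1 P ≤ (Real.toNNReal (1 + ∑' t, b t ^ 2) : NNReal) := by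
    rw [eLpNorm_one_eq_lintegral_enorm, ← ofReal_integral_norm_eq_lintegral_enorm (hMI n)]
    refine ENNReal.ofReal_le_ofReal ?_
    -- The variance bound yields the `L¹` bound required by martingale convergence through `|x| ≤ 1
    -- + x ^ 2`.
    have h1 : ∫ ω, ‖M n ω‖ ∂P ≤ ∫ ω, (1 + M n ω ^ 2) ∂P :=
      integral_mono (hMI n).norm ((integrable_const 1).add (hML n).integrable_sq) fun ω => by
        rw [Real.norm_eq_abs, ← sq_abs]
        nlinarith [sq_nonneg (|M n ω| - 1), abs_nonneg (M n ω)]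
    rw [integral_add (integrable_const 1) (hML n).integrable_sq] at h1
    simp only [integral_const, probReal_univ, smul_eq_mul, mul_one] at h1
    linarith [hvar n]
  filter_upwards [hmart.submartingale.ae_tendsto_limitProcess hbdd] with ω hω
  refine ⟨_, (tendsto_add_atTop_iff_nat 1).1 (hω.congr fun n => ?_)⟩
  simp [hM]

variable {N : ℕ}

/-! ### Perturbed leaders and their expected regret. -/

/-- The leaders: the minimizers of `y`. -/
noncomputable def leaders (y : Fin N → ℝ) : Finset (Fin N) :=
  Finset.univ.filter fun i => ∀ j, y i ≤ y j

theorem mem_leaders {y : Fin N → ℝ} {i : Fin N} : i ∈ leaders y ↔ ∀ j, y i ≤ y j := by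
  simp [leaders]

theorem leaders_sub_const (y : Fin N → ℝ) (k : ℝ) : leaders (fun i => y i - k) = leaders y := by
  ext i
  simp [mem_leaders]

theorem cumLoss_succ (s : ℕ → Fin N → ℝ) (t : ℕ) (i : Fin N) :
    cumLoss s (t + 1) i = cumLoss s t i + s (t + 1) i := by
  simp [cumLoss, Finset.sum_Icc_succ_top]

variable [NeZero N]

theorem leaders_nonempty (y : Fin N → ℝ) : (leaders y).Nonempty :=
  (Finite.exists_min y).imp fun _ h => mem_leaders.2 h

/-- The largest loss `c i` of a leader `i`. -/
noncomputable def topLoss (c y : Fin N → ℝ) : ℝ := (leaders y).sup' (leaders_nonempty y) c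

theorem le_topLoss {c y : Fin N → ℝ} {i : Fin N} (hi : ∀ j, y i ≤ y j) : c i ≤ topLoss c y :=
  Finset.le_sup' c (mem_leaders.2 hi)

theorem exists_topLoss_eq (c y : Fin N → ℝ) : ∃ i, (∀ j, y i ≤ y j) ∧ topLoss c y = c i := by
  obtain ⟨i, hi, h⟩ := Finset.exists_mem_eq_sup' (leaders_nonempty y) c
  exact ⟨i, mem_leaders.1 hi, h⟩

theorem topLoss_sub_const (c y : Fin N → ℝ) (k : ℝ) :
    topLoss c (fun i => y i - k) = topLoss c y := by
  simp only [topLoss, leaders_sub_const]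

theorem abs_topLoss_le {c : Fin N → ℝ} {M : ℝ} (hc : ∀ i, |c i| ≤ M) (y : Fin N → ℝ) :
    |topLoss c y| ≤ M := by
  obtain ⟨i, -, h⟩ := exists_topLoss_eq c y
  rw [h]
  exact hc i

theorem measurable_topLoss (c : Fin N → ℝ) : Measurable (topLoss c) := by
  refine measurable_of_Ioi fun a => ?_
  have : topLoss c ⁻¹' Set.Ioi a = ⋃ i, ⋃ (_ : a < c i), ⋂ j, {y | y i ≤ y j} := by
    ext y
    simp [topLoss, Finset.lt_sup'_iff, mem_leaders, and_comm]
  rw [this]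
  exact MeasurableSet.iUnion fun i => MeasurableSet.iUnion fun _ => MeasurableSet.iInter fun j =>
    measurableSet_le (measurable_pi_apply i) (measurable_pi_apply j)

theorem measurable_topLoss_perturbed (c L : Fin N → ℝ) (η : ℝ) :
    Measurable fun x : Fin N → ℝ => topLoss c fun i => L i - η * x i :=
  (measurable_topLoss c).comp (by fun_prop)

theorem integrable_topLoss_perturbed (c L : Fin N → ℝ) (η : ℝ) :
    Integrable (fun x : Fin N → ℝ => topLoss c fun i => L i - η * x i) (expLaw N) :=
  Integrable.of_bound (measurable_topLoss_perturbed c L η).aestronglyMeasurable (∑ k, |c k|)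
    (Eventually.of_forall fun _ => abs_topLoss_le (fun i =>
      Finset.single_le_sum (f := fun k => |c k|) (fun _ _ => abs_nonneg _) (Finset.mem_univ i)) _)

/-- Following the perturbed leader is not much worse than following the perturbed leader that
already knows the losses `c` of the current step. -/
theorem integral_topLoss_le_add {c : Fin N → ℝ} {M : ℝ} (hc : ∀ i, |c i| ≤ M) (L : Fin N → ℝ)
    {η : ℝ} (hη : 0 < η) :
    ∫ x, topLoss c (fun i => L i - η * x i) ∂(expLaw N) ≤
      ∫ x, topLoss c (fun i => L i + c i - η * x i) ∂(expLaw N) + 4 * N * M / η * M := by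
  have hM : 0 ≤ M := (abs_nonneg _).trans (hc 0)
  -- Translating `x` by `h` lowers every score by `M + c i`: this cancels the loss `c i` and leaves
  -- a common constant, harmless to the leaders. The summand `M` makes `h` nonnegative.
  set h : Fin N → ℝ := fun i => (M + c i) / η with hh
  have hc' (i : Fin N) : -M ≤ c i ∧ c i ≤ M := abs_le.1 (hc i)
  have h0 (i : Fin N) : 0 ≤ h i := div_nonneg (by linarith [(hc' i).1]) hη.le
  set H : ℝ := ∑ i, h i with hH
  have hHle : H ≤ 2 * N * M / η := by
    have : H ≤ ∑ _i : Fin N, 2 * M / η := Finset.sum_le_sum fun i _ =>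
      div_le_div_of_nonneg_right (by linarith [(hc' i).2]) hη.le
    simp only [Finset.sum_const, Finset.card_univ, Fintype.card_fin, nsmul_eq_mul] at this
    calc H ≤ _ := this
      _ = _ := by ring
  have hi1 := integrable_topLoss_perturbed c L η
  have hi2 := integrable_topLoss_perturbed c (fun i => L i + c i) η
  -- Adding `M` to the loss makes it nonnegative, as the comparison of laws requires.
  have key := integral_comp_add_le_expLaw h0
    (F := fun x => M + topLoss c (fun i => L i + c i - η * x i))
    ((measurable_topLoss_perturbed c (fun i => L i + c i) η).const_add M)
    (fun x => by linarith [(abs_le.1 (abs_topLoss_le hc (fun i => L i + c i - η * x i))).1])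
    ((integrable_const M).add hi2)
  have hshift (x : Fin N → ℝ) : topLoss c (fun i => L i + c i - η * (x + h) i) =
      topLoss c (fun i => L i - η * x i) := by
    rw [← topLoss_sub_const c (fun i => L i - η * x i) M]
    congr 1
    ext i
    simp only [hh, Pi.add_apply]
    field_simp
    ring
  simp only [hshift] at key
  rw [integral_add (integrable_const M) hi1, integral_add (integrable_const M) hi2] at key
  simp only [integral_const, probReal_univ, smul_eq_mul, one_mul] at key
  have hA : ∫ x, topLoss c (fun i => L i - η * x i) ∂(expLaw N) ≤ M := by
    have := integral_mono hi1 (integrable_const M)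
      fun x => (abs_le.1 (abs_topLoss_le hc (fun i => L i - η * x i))).2
    simpa using this
  have hA0 : -M ≤ ∫ x, topLoss c (fun i => L i - η * x i) ∂(expLaw N) := by
    have := integral_mono (integrable_const (-M)) hi1
      fun x => (abs_le.1 (abs_topLoss_le hc (fun i => L i - η * x i))).1
    simpa using this
  set A := ∫ x, topLoss c (fun i => L i - η * x i) ∂(expLaw N)
  set B := ∫ x, topLoss c (fun i => L i + c i - η * x i) ∂(expLaw N)
  -- The factor `exp H` is linearised by `1 - H ≤ exp (-H)`; the loss `H * (M + A)` is small because
  -- `M + A ≤ 2 * M`.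
  have hB : (1 - H) * (M + A) ≤ M + B :=
    calc (1 - H) * (M + A) ≤ Real.exp (-H) * (M + A) :=
          mul_le_mul_of_nonneg_right (by linarith [Real.add_one_le_exp (-H)]) (by linarith)
      _ ≤ Real.exp (-H) * (Real.exp H * (M + B)) :=
          mul_le_mul_of_nonneg_left key (Real.exp_pos _).le
      _ = M + B := by rw [← mul_assoc, ← Real.exp_add]; simp
  have hH0 : 0 ≤ H := Finset.sum_nonneg fun i _ => h0 i
  have h4 : H * (M + A) ≤ 2 * N * M / η * (2 * M) :=
    mul_le_mul hHle (by linarith) (by linarith) (hH0.trans hHle)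
  have h5 : 2 * N * M / η * (2 * M) = 4 * N * M / η * M := by ring
  linarith

/-- Be the leader: the leader that knows the losses of the current step and uses the same
perturbation `x` at every step, with scales `h t`, has small regret. -/
theorem sum_topLoss_le_cumLoss (s : ℕ → Fin N → ℝ) {h d : ℕ → ℝ} (hh : ∀ t, 0 ≤ h t)
    (hd : ∀ t, 0 ≤ d t) (hhd : ∀ t, h (t + 1) ≤ h t + d t) {x : Fin N → ℝ} (hx : ∀ i, 0 ≤ x i)
    (T : ℕ) (i : Fin N) :
    ∑ t ∈ Finset.range T, topLoss (s (t + 1)) (fun i => cumLoss s (t + 1) i - h t * x i) ≤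
      cumLoss s T i + (h 0 + ∑ t ∈ Finset.range T, d t) * ∑ i, x i := by
  have hxs (i : Fin N) : x i ≤ ∑ k, x k :=
    Finset.single_le_sum (fun k _ => hx k) (Finset.mem_univ i)
  have hs0 : 0 ≤ ∑ k, x k := Finset.sum_nonneg fun k _ => hx k
  -- The induction keeps the term `- h T * x i` and all `i`: the hypothesis is applied to the new
  -- leader `J`, and raising the scale costs at most `d T * x J`.
  have key (T : ℕ) : ∀ i, ∑ t ∈ Finset.range (T + 1),
      topLoss (s (t + 1)) (fun i => cumLoss s (t + 1) i - h t * x i) ≤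
      cumLoss s (T + 1) i - h T * x i + (h 0 + ∑ t ∈ Finset.range T, d t) * ∑ i, x i := by
    induction T with
    | zero =>
      intro i
      obtain ⟨J, hJ, hJ'⟩ := exists_topLoss_eq (s 1) (fun i => cumLoss s 1 i - h 0 * x i)
      have h1 : cumLoss s 1 J = s 1 J := by simp [cumLoss]
      have h2 := hJ i
      have h3 := mul_le_mul_of_nonneg_left (hxs J) (hh 0)
      simp only [zero_add, Finset.sum_range_one, Finset.sum_range_zero, add_zero, hJ']
      linarith
    | succ T ih =>
      intro i
      obtain ⟨J, hJ, hJ'⟩ := exists_topLoss_eq (s (T + 1 + 1))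
        (fun i => cumLoss s (T + 1 + 1) i - h (T + 1) * x i)
      have h1 := cumLoss_succ s (T + 1) J
      have h2 := hJ i
      have h3 := mul_le_mul_of_nonneg_left (hxs J) (hd T)
      have h4 := mul_le_mul_of_nonneg_right (hhd T) (hx J)
      have h5 := ih J
      rw [Finset.sum_range_succ, hJ', Finset.sum_range_succ d T]
      linarith
  cases T with
  | zero => simpa [cumLoss] using mul_nonneg (hh 0) hs0
  | succ T =>
    have h1 := key T i
    have h2 := mul_nonneg (hh T) (hx i)
    have h3 := mul_nonneg (hd T) hs0
    rw [Finset.sum_range_succ d T]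
    linarith

/-- Each expectation depends only on the law at its own step, so all of them may be taken over a
common `x`, to which the pathwise bound applies. -/
theorem sum_integral_topLoss_le_bestLoss (s : ℕ → Fin N → ℝ) {h d : ℕ → ℝ} (hh : ∀ t, 0 ≤ h t)
    (hd : ∀ t, 0 ≤ d t) (hhd : ∀ t, h (t + 1) ≤ h t + d t) (T : ℕ) :
    ∑ t ∈ Finset.range T,
        ∫ x, topLoss (s (t + 1)) (fun i => cumLoss s (t + 1) i - h t * x i) ∂(expLaw N) ≤
      bestLoss s T + (h 0 + ∑ t ∈ Finset.range T, d t) * ∫ x, ∑ i, x i ∂(expLaw N) := by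
  obtain ⟨i, -, hi⟩ := Finset.exists_mem_eq_inf' Finset.univ_nonempty (fun i => cumLoss s T i)
  rw [bestLoss, hi, ← integral_finsetSum _ fun t _ => integrable_topLoss_perturbed _ _ _]
  have h1 := integral_mono_ae
    (integrable_finsetSum (Finset.range T) fun t _ =>
      integrable_topLoss_perturbed (s (t + 1)) (cumLoss s (t + 1)) (h t))
    ((integrable_const (cumLoss s T i)).add
      ((integrable_sum_expLaw N).const_mul (h 0 + ∑ t ∈ Finset.range T, d t)))
    ((ae_nonneg_expLaw N).mono fun x hx => sum_topLoss_le_cumLoss s hh hd hhd hx T i)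
  refine h1.trans_eq ?_
  rw [integral_add' (integrable_const _) ((integrable_sum_expLaw N).const_mul _),
    integral_const_mul]
  simp

/-! ### Volume, fluctuation and the scale of the perturbations. -/

theorem abs_le_maxAbsLoss (s : ℕ → Fin N → ℝ) (t : ℕ) (i : Fin N) : |s t i| ≤ maxAbsLoss s t :=
  Finset.le_sup' (fun i => |s t i|) (Finset.mem_univ i)

theorem maxAbsLoss_nonneg (s : ℕ → Fin N → ℝ) (t : ℕ) : 0 ≤ maxAbsLoss s t :=
  (abs_nonneg _).trans (abs_le_maxAbsLoss s t 0)

theorem volume_succ (v₀ : ℝ) (s : ℕ → Fin N → ℝ) (t : ℕ) :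
    volume v₀ s (t + 1) = volume v₀ s t + maxAbsLoss s (t + 1) := by
  simp [volume, Finset.sum_Icc_succ_top, add_assoc]

theorem volume_monotone (v₀ : ℝ) (s : ℕ → Fin N → ℝ) : Monotone (volume v₀ s) :=
  monotone_nat_of_le_succ fun t => by
    rw [volume_succ]
    linarith [maxAbsLoss_nonneg s (t + 1)]

theorem volume_nonneg {v₀ : ℝ} (hv₀ : 0 ≤ v₀) (s : ℕ → Fin N → ℝ) (t : ℕ) :
    0 ≤ volume v₀ s t :=
  add_nonneg hv₀ (Finset.sum_nonneg fun j _ => maxAbsLoss_nonneg s j)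

theorem maxAbsLoss_le_of_fluc_le {v₀ : ℝ} (hv₀ : 0 ≤ v₀) {s : ℕ → Fin N → ℝ} {t : ℕ} {g : ℝ}
    (h : fluc v₀ s (t + 1) ≤ g) : maxAbsLoss s (t + 1) ≤ g * volume v₀ s (t + 1) := by
  rcases (volume_nonneg hv₀ s (t + 1)).eq_or_lt with h0 | h0
  · rw [← h0, mul_zero]
    linarith [volume_succ v₀ s t, volume_nonneg hv₀ s t]
  · exact (div_le_iff₀ h0).1 h

/-- In a non-degenerate game the bound `γ` of the fluctuations never vanishes. -/
theorem NonDegenerate.fluc_bound_pos {v₀ : ℝ} (hv₀ : 0 ≤ v₀) {s : ℕ → Fin N → ℝ}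
    (hnd : NonDegenerate v₀ s) {γ : ℕ → ℝ} (hγ_anti : AntitoneOn γ (Set.Ici 1))
    (hfluc : ∀ t, 1 ≤ t → fluc v₀ s t ≤ γ t) (t : ℕ) : 0 < γ (t + 1) := by
  by_contra! hle
  -- If the bound vanished at step `t + 1`, monotonicity would force all later losses to be zero and
  -- freeze the volume.
  have hconst (u : ℕ) : volume v₀ s (t + u) = volume v₀ s t := by
    induction u with
    | zero => rfl
    | succ u ih =>
      have h1 : γ (t + u + 1) ≤ 0 :=
        (hγ_anti (by simp) (by simp) (by omega)).trans hle
      have h2 := maxAbsLoss_le_of_fluc_le hv₀ (hfluc (t + u + 1) (by omega))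
      have h3 := mul_nonpos_of_nonpos_of_nonneg h1 (volume_nonneg hv₀ s (t + u + 1))
      rw [← add_assoc, volume_succ, ih]
      linarith [maxAbsLoss_nonneg s (t + u + 1)]
  obtain ⟨u, hu⟩ := ((tendsto_add_atTop_iff_nat t).2 hnd).eventually_gt_atTop (volume v₀ s t)
    |>.exists
  rw [add_comm, hconst] at hu
  exact lt_irrefl _ hu

/-- The constant factor of the scaling `mu`. -/
noncomputable def muCoeff (N : ℕ) (a : ℝ) : ℝ :=
  √(2 * a * (Real.exp (3 / a) - 1) / (1 + Real.log N))

theorem mu_eq_muCoeff_mul_sqrt (N : ℕ) (a g : ℝ) : mu N a g = muCoeff N a * √g := by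
  rw [mu, muCoeff, Real.sqrt_eq_rpow g]

theorem muCoeff_pos (N : ℕ) {a : ℝ} (ha : 0 < a) : 0 < muCoeff N a := by
  have hN : 0 ≤ Real.log N := Real.log_natCast_nonneg N
  have he : 0 < Real.exp (3 / a) - 1 := by
    have := Real.add_one_lt_exp (x := 3 / a) (by positivity)
    have : 0 < 3 / a := by positivity
    linarith
  exact Real.sqrt_pos.2 (by positivity)

theorem mu_nonneg (N : ℕ) (a g : ℝ) : 0 ≤ mu N a g := by
  rw [mu_eq_muCoeff_mul_sqrt]
  exact mul_nonneg (Real.sqrt_nonneg _) (Real.sqrt_nonneg _)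

theorem mu_mono (N : ℕ) (a : ℝ) : Monotone (mu N a) := fun g g' h => by
  rw [mu_eq_muCoeff_mul_sqrt, mu_eq_muCoeff_mul_sqrt]
  exact mul_le_mul_of_nonneg_left (Real.sqrt_le_sqrt h) (Real.sqrt_nonneg _)

theorem tendsto_mu_zero (N : ℕ) (a : ℝ) {γ : ℕ → ℝ} (hγ : Tendsto γ atTop (𝓝 0)) :
    Tendsto (fun t => mu N a (γ t)) atTop (𝓝 0) := by
  simp only [mu_eq_muCoeff_mul_sqrt]
  simpa using (hγ.sqrt).const_mul (muCoeff N a)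

/-- The scale `1 / ε_{t+1} = μ_{t+1} v_t` of the perturbations at step `t + 1`. -/
noncomputable def scale (a : ℝ) (γ : ℕ → ℝ) (v₀ : ℝ) (s : ℕ → Fin N → ℝ) (t : ℕ) : ℝ :=
  mu N a (γ (t + 1)) * volume v₀ s t

theorem one_div_learningRate (a : ℝ) (γ : ℕ → ℝ) (v₀ : ℝ) (s : ℕ → Fin N → ℝ) (t : ℕ) :
    1 / learningRate a γ v₀ s (t + 1) = scale a γ v₀ s t := by
  simp [learningRate, scale]

theorem scale_nonneg (a : ℝ) (γ : ℕ → ℝ) {v₀ : ℝ} (hv₀ : 0 ≤ v₀) (s : ℕ → Fin N → ℝ) (t : ℕ) :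
    0 ≤ scale a γ v₀ s t :=
  mul_nonneg (mu_nonneg _ _ _) (volume_nonneg hv₀ s t)

/-- The scale need not be monotone, but since `μ` does not increase, it can grow only through the
volume. This is the drift `d` of the be-the-leader bound. -/
theorem scale_succ_le (a : ℝ) {γ : ℕ → ℝ} (hγ_anti : AntitoneOn γ (Set.Ici 1)) {v₀ : ℝ}
    (hv₀ : 0 ≤ v₀) (s : ℕ → Fin N → ℝ) (t : ℕ) :
    scale a γ v₀ s (t + 1) ≤
      scale a γ v₀ s t + mu N a (γ (t + 2)) * (volume v₀ s (t + 1) - volume v₀ s t) := by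
  have h1 : mu N a (γ (t + 2)) ≤ mu N a (γ (t + 1)) :=
    mu_mono N a (hγ_anti (by simp) (by simp) (by omega))
  have h2 := mul_le_mul_of_nonneg_right h1 (volume_nonneg hv₀ s t)
  simp only [scale]
  linarith

/-- A bound of the price, relative to the growth of the volume, of not knowing the losses of step
`t + 1` in advance. -/
noncomputable def ignorancePrice (a : ℝ) (γ : ℕ → ℝ) (v₀ : ℝ) (s : ℕ → Fin N → ℝ) (t : ℕ) : ℝ :=
  if 0 < scale a γ v₀ s t then 4 * N * maxAbsLoss s (t + 1) / scale a γ v₀ s t else 2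

/-- Eventually the one-step loss is at most `2 γ v` while the scale is `muCoeff * √γ * v`, so the
price is `O(√γ)`. Positivity of `γ` ensures that the default value 2 occurs only finitely often. -/
theorem tendsto_ignorancePrice {a : ℝ} (ha : 0 < a) {γ : ℕ → ℝ} {v₀ : ℝ} (hv₀ : 0 ≤ v₀)
    {s : ℕ → Fin N → ℝ} (hγ_anti : AntitoneOn γ (Set.Ici 1)) (hγ_lim : Tendsto γ atTop (𝓝 0))
    (hfluc : ∀ t, 1 ≤ t → fluc v₀ s t ≤ γ t) (hnd : NonDegenerate v₀ s) :
    Tendsto (ignorancePrice a γ v₀ s) atTop (𝓝 0) := by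
  have hc := muCoeff_pos N ha
  have hγ1 : Tendsto (fun t => γ (t + 1)) atTop (𝓝 0) := (tendsto_add_atTop_iff_nat 1).2 hγ_lim
  refine squeeze_zero' (g := fun t => 8 * N / muCoeff N a * √(γ (t + 1)))
    (Eventually.of_forall fun t => ?_) ?_ ?_
  · rw [ignorancePrice]
    split_ifs with h
    · have := maxAbsLoss_nonneg s (t + 1)
      positivity
    · norm_num
  · filter_upwards [hnd.eventually_gt_atTop 0, hγ1.eventually_le_const (show (0 : ℝ) < 1 / 2 by
      norm_num)] with t hV hγt
    have hpos := hnd.fluc_bound_pos hv₀ hγ_anti hfluc t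
    have hsq := Real.sqrt_pos.2 hpos
    have hscale : scale a γ v₀ s t = muCoeff N a * √(γ (t + 1)) * volume v₀ s t := by
      rw [scale, mu_eq_muCoeff_mul_sqrt]
    have h1 := maxAbsLoss_le_of_fluc_le hv₀ (hfluc (t + 1) (by omega))
    rw [volume_succ] at h1
    -- Here `γ ≤ 1 / 2` absorbs the current loss contained in `v_{t+1}`.
    have h2 : maxAbsLoss s (t + 1) ≤ 2 * γ (t + 1) * volume v₀ s t := by
      nlinarith [mul_le_mul_of_nonneg_right hγt (maxAbsLoss_nonneg s (t + 1))]
    have hs : 0 < scale a γ v₀ s t := by rw [hscale]; positivity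
    rw [ignorancePrice, if_pos hs, div_le_iff₀ hs, hscale]
    have h3 : 8 * N / muCoeff N a * √(γ (t + 1)) * (muCoeff N a * √(γ (t + 1)) * volume v₀ s t) =
        4 * N * (2 * γ (t + 1) * volume v₀ s t) := by
      have := Real.mul_self_sqrt hpos.le
      field_simp
      rw [Real.sq_sqrt hpos.le]
      ring
    rw [h3]
    exact mul_le_mul_of_nonneg_left h2 (by positivity)
  · simpa using hγ1.sqrt.const_mul (8 * N / muCoeff N a)

/-! ### Expected regret of the algorithm. -/

/-- The expected loss at step `t + 1` of a leader among the perturbed cumulative losses `L`. -/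
noncomputable def meanLoss (a : ℝ) (γ : ℕ → ℝ) (v₀ : ℝ) (s : ℕ → Fin N → ℝ) (t : ℕ)
    (L : Fin N → ℝ) : ℝ :=
  ∫ x, topLoss (s (t + 1)) (fun i => L i - scale a γ v₀ s t * x i) ∂(expLaw N)

theorem abs_meanLoss_le (a : ℝ) (γ : ℕ → ℝ) (v₀ : ℝ) (s : ℕ → Fin N → ℝ) (t : ℕ)
    (L : Fin N → ℝ) : |meanLoss a γ v₀ s t L| ≤ maxAbsLoss s (t + 1) := by
  have := norm_integral_le_of_norm_le_const (μ := expLaw N) (C := maxAbsLoss s (t + 1))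
    (f := fun x => topLoss (s (t + 1)) (fun i => L i - scale a γ v₀ s t * x i))
    (Eventually.of_forall fun x => abs_topLoss_le (abs_le_maxAbsLoss s (t + 1)) _)
  simpa [meanLoss] using this

theorem meanLoss_cumLoss_le (a : ℝ) (γ : ℕ → ℝ) (v₀ : ℝ) (s : ℕ → Fin N → ℝ) (t : ℕ) :
    meanLoss a γ v₀ s t (cumLoss s t) ≤ meanLoss a γ v₀ s t (cumLoss s (t + 1)) +
      ignorancePrice a γ v₀ s t * (volume v₀ s (t + 1) - volume v₀ s t) := by
  rw [volume_succ, add_sub_cancel_left, ignorancePrice]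
  split_ifs with h
  · have := integral_topLoss_le_add (abs_le_maxAbsLoss s (t + 1)) (cumLoss s t) h
    simp only [← cumLoss_succ] at this
    exact this
  -- Without a positive scale, both expectations still lie within one `maxAbsLoss` of 0, whence the
  -- default price 2.
  · linarith [(abs_le.1 (abs_meanLoss_le a γ v₀ s t (cumLoss s t))).2,
      (abs_le.1 (abs_meanLoss_le a γ v₀ s t (cumLoss s (t + 1)))).1]

/-- The expected regret of the perturbed leader. -/
theorem sum_meanLoss_le (a : ℝ) {γ : ℕ → ℝ} (hγ_anti : AntitoneOn γ (Set.Ici 1)) {v₀ : ℝ}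
    (hv₀ : 0 ≤ v₀) (s : ℕ → Fin N → ℝ) (T : ℕ) :
    ∑ t ∈ Finset.range T, meanLoss a γ v₀ s t (cumLoss s t) ≤ bestLoss s T +
      (scale a γ v₀ s 0 + ∑ t ∈ Finset.range T,
        mu N a (γ (t + 2)) * (volume v₀ s (t + 1) - volume v₀ s t)) *
          ∫ x, ∑ i, x i ∂(expLaw N) +
      ∑ t ∈ Finset.range T,
        ignorancePrice a γ v₀ s t * (volume v₀ s (t + 1) - volume v₀ s t) := by
  have h1 := Finset.sum_le_sum fun t (_ : t ∈ Finset.range T) => meanLoss_cumLoss_le a γ v₀ s t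
  rw [Finset.sum_add_distrib] at h1
  have h2 := sum_integral_topLoss_le_bestLoss s (scale_nonneg a γ hv₀ s)
    (d := fun t => mu N a (γ (t + 2)) * (volume v₀ s (t + 1) - volume v₀ s t))
    (fun t => mul_nonneg (mu_nonneg _ _ _) (sub_nonneg.2 (volume_monotone v₀ s t.le_succ)))
    (scale_succ_le a hγ_anti hv₀ s) T
  simp only [meanLoss] at h1 ⊢
  linarith

/-! ### From expected to actual losses. -/

/-- The loss at step `t + 1` of the worst leader for the perturbation `x`. -/
noncomputable def leaderLoss (a : ℝ) (γ : ℕ → ℝ) (v₀ : ℝ) (s : ℕ → Fin N → ℝ) (t : ℕ)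
    (x : Fin N → ℝ) : ℝ :=
  topLoss (s (t + 1)) fun i => cumLoss s t i - scale a γ v₀ s t * x i

theorem measurable_leaderLoss (a : ℝ) (γ : ℕ → ℝ) (v₀ : ℝ) (s : ℕ → Fin N → ℝ) (t : ℕ) :
    Measurable (leaderLoss a γ v₀ s t) :=
  measurable_topLoss_perturbed _ _ _

theorem abs_leaderLoss_sub_meanLoss_le (a : ℝ) (γ : ℕ → ℝ) (v₀ : ℝ) (s : ℕ → Fin N → ℝ) (t : ℕ)
    (x : Fin N → ℝ) : |leaderLoss a γ v₀ s t x - meanLoss a γ v₀ s t (cumLoss s t)| ≤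
      2 * maxAbsLoss s (t + 1) := by
  have h1 := abs_le.1 (abs_topLoss_le (abs_le_maxAbsLoss s (t + 1))
    fun i => cumLoss s t i - scale a γ v₀ s t * x i)
  have h2 := abs_le.1 (abs_meanLoss_le a γ v₀ s t (cumLoss s t))
  rw [leaderLoss, abs_le]
  constructor <;> linarith [h1.1, h1.2, h2.1, h2.2]

/-- Charging the worst leader covers every tie-breaking rule, so no measurability of `I` is needed.
-/
theorem algLoss_le_sum_leaderLoss {Ω : Type*} {a : ℝ} {γ : ℕ → ℝ} {v₀ : ℝ} {s : ℕ → Fin N → ℝ}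
    {ξ : ℕ → Fin N → Ω → ℝ} {I : ℕ → Ω → Fin N} (hI : IsPROT a γ v₀ s ξ I) (T : ℕ) (ω : Ω) :
    algLoss s I T ω ≤
      ∑ t ∈ Finset.range T, leaderLoss a γ v₀ s t (fun i => ξ (t + 1) i ω) := by
  induction T with
  | zero => simp [algLoss]
  | succ T ih =>
    have h1 : algLoss s I (T + 1) ω = algLoss s I T ω + s (T + 1) (I (T + 1) ω) := by
      simp [algLoss, Finset.sum_Icc_succ_top]
    rw [h1, Finset.sum_range_succ]
    refine add_le_add ih (le_topLoss fun j => ?_)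
    have := hI (T + 1) (by omega) ω j
    rwa [one_div_learningRate, Nat.add_sub_cancel] at this

/-- The actual losses of the leaders deviate from their expectations by `o(v_T)`. -/
theorem ae_tendsto_sum_leaderLoss_sub_meanLoss {Ω : Type*} [MeasurableSpace Ω] {P : Measure Ω}
    [IsProbabilityMeasure P] {ζ : ℕ → Ω → Fin N → ℝ} (hζ : ∀ t, Measurable (ζ t))
    (hlaw : ∀ t, P.map (ζ t) = expLaw N) (hind : iIndepFun ζ P) (a : ℝ) {γ : ℕ → ℝ} {v₀ : ℝ}
    (hv₀ : 0 ≤ v₀) {s : ℕ → Fin N → ℝ} (hγ_nonneg : ∀ t, 1 ≤ t → 0 ≤ γ t)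
    (hfluc : ∀ t, 1 ≤ t → fluc v₀ s t ≤ γ t) (hnd : NonDegenerate v₀ s)
    (hγ_sq : Summable (fun t : ℕ => γ (t + 1) ^ 2)) :
    ∀ᵐ ω ∂P, Tendsto (fun T => (∑ t ∈ Finset.range T, (leaderLoss a γ v₀ s t (ζ t ω) -
      meanLoss a γ v₀ s t (cumLoss s t))) / volume v₀ s T) atTop (𝓝 0) := by
  set m : ℕ → ℝ := fun t => meanLoss a γ v₀ s t (cumLoss s t) with hm
  set V : ℕ → ℝ := volume v₀ s with hV
  have hbd (t : ℕ) (x : Fin N → ℝ) :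
      |leaderLoss a γ v₀ s t x - m t| ≤ 2 * γ (t + 1) * V (t + 1) := by
    linarith [abs_leaderLoss_sub_meanLoss_le a γ v₀ s t x,
      maxAbsLoss_le_of_fluc_le hv₀ (hfluc (t + 1) (by omega))]
  -- Dividing by `V (t + 1)` turns the bound into `2 * γ (t + 1)`, which is square summable;
  -- Kronecker's lemma restores the weights.
  have hmeas (t : ℕ) : Measurable fun x => (leaderLoss a γ v₀ s t x - m t) / V (t + 1) :=
    ((measurable_leaderLoss a γ v₀ s t).sub_const _).div_const _
  have hint (t : ℕ) : ∫ ω, leaderLoss a γ v₀ s t (ζ t ω) ∂P = m t := by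
    simp only [hm, meanLoss]
    rw [← hlaw t]
    exact (integral_map (hζ t).aemeasurable
      (measurable_leaderLoss a γ v₀ s t).aestronglyMeasurable).symm
  have hintg (t : ℕ) : Integrable (fun ω => leaderLoss a γ v₀ s t (ζ t ω)) P :=
    Integrable.of_bound ((measurable_leaderLoss a γ v₀ s t).comp (hζ t)).aestronglyMeasurable
      (maxAbsLoss s (t + 1))
      (Eventually.of_forall fun _ => abs_topLoss_le (abs_le_maxAbsLoss s (t + 1)) _)
  have hconv := ae_tendsto_sum_of_iIndepFun (P := P) (b := fun t => 2 * γ (t + 1))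
    (fun t => (hmeas t).comp (hζ t)) (hind.comp _ hmeas)
    (fun t => by
      simp only [Function.comp_def]
      rw [integral_div, integral_sub (hintg t) (integrable_const _), hint]
      simp)
    (fun t ω => by
      rw [Function.comp_apply, abs_div, abs_of_nonneg (volume_nonneg hv₀ s (t + 1))]
      exact div_le_of_le_mul₀ (volume_nonneg hv₀ s (t + 1))
        (by linarith [hγ_nonneg (t + 1) (by omega)]) (hbd t _))
    (by simpa only [mul_pow] using hγ_sq.mul_left (2 ^ 2))
  filter_upwards [hconv] with ω ⟨l, hl⟩
  refine (kronecker (volume_monotone v₀ s) hnd hl).congr fun T => ?_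
  congr 1
  refine Finset.sum_congr rfl fun t _ => ?_
  rw [Function.comp_apply]
  -- If `V (t + 1) = 0`, the quotient is the default 0, and `hbd` forces the numerator to vanish as
  -- well.
  refine mul_div_cancel_of_imp' fun h0 => ?_
  have := hbd t (ζ t ω)
  rw [hV, h0, mul_zero] at this
  exact abs_nonpos_iff.1 this

end PredictionGame

/-! ### Assembling the bounds. -/

theorem theorem2 {Ω : Type*} [MeasurableSpace Ω] (P : Measure Ω) [IsProbabilityMeasure P]
    {N : ℕ} [NeZero N]
    -- oblivious experts: the losses `s t i` are deterministic, of either sign and unbounded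
    (s : ℕ → Fin N → ℝ) (v₀ : ℝ) (hv₀ : 0 ≤ v₀)
    (a : ℝ) (ha : 0 < a)
    (γ : ℕ → ℝ) (hγ_anti : AntitoneOn γ (Set.Ici 1))
    (hγ_nonneg : ∀ t, 1 ≤ t → 0 ≤ γ t) (hγ_le_one : ∀ t, 1 ≤ t → γ t ≤ 1)
    (hγ_lim : Tendsto γ atTop (𝓝 0))
    (hfluc : ∀ t, 1 ≤ t → PredictionGame.fluc v₀ s t ≤ γ t)
    (hnondeg : PredictionGame.NonDegenerate v₀ s)
    (hγ_sq : Summable (fun t : ℕ => γ (t + 1) ^ 2))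
    (ξ : ℕ → Fin N → Ω → ℝ) (hξ : PredictionGame.IsExpIID P ξ)
    (I : ℕ → Ω → Fin N) (hI : PredictionGame.IsPROT a γ v₀ s ξ I) :
    PredictionGame.HannanConsistent P v₀ s I := by
  open PredictionGame in
  obtain ⟨ζ, hζ, hlaw, hind, hζξ⟩ := hξ.exists_rows
  set K : ℝ := ∫ x, ∑ i, x i ∂(expLaw N) with hK
  have hmono := volume_monotone v₀ s
  have hleft := ((tendsto_weighted_average_zero hmono hnondeg (tendsto_mu_zero N a
    ((tendsto_add_atTop_iff_nat 2).2 hγ_lim))).add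
    (Tendsto.const_div_atTop hnondeg (scale a γ v₀ s 0))).mul_const K
  have hright := tendsto_weighted_average_zero hmono hnondeg
    (tendsto_ignorancePrice ha hv₀ hγ_anti hγ_lim hfluc hnondeg)
  filter_upwards [hζξ, ae_tendsto_sum_leaderLoss_sub_meanLoss hζ hlaw hind a hv₀ hγ_nonneg hfluc
    hnondeg hγ_sq] with ω hω hdev
  have hlim := (hdev.add hleft).add hright
  simp only [add_zero, zero_mul] at hlim
  have hlim' := (continuous_coe_real_ereal.tendsto 0).comp hlim
  -- The sum of the three normalised errors (deviation, drift of the scale, ignorance) tends to 0,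
  -- so it suffices to dominate the normalised regret by it for each `T`.
  rw [← EReal.coe_zero, ← hlim'.limsup_eq]
  refine limsup_le_limsup (Eventually.of_forall fun T => ?_)
  rw [Function.comp_apply, EReal.coe_le_coe_iff]
  have h1 := algLoss_le_sum_leaderLoss hI T ω
  have h2 := sum_meanLoss_le a hγ_anti hv₀ s T
  simp only [hω] at h1
  rw [one_div_mul_eq_div, ← add_div, div_mul_eq_mul_div, ← add_div, ← add_div]
  refine div_le_div_of_nonneg_right ?_ (volume_nonneg hv₀ s T)
  rw [Finset.sum_sub_distrib, add_comm (∑ t ∈ Finset.range T, mu N a (γ (t + 2)) * _)]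
  linarith
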